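/- Conventions. In a partial order $P$, $p\le q$ means that $q$ is stronger than $p$; $p,q$ are compatible if they have a common upper bound. $P$ is separative if whenever $p\not\le q$ there is $r\ge q$ incompatible with $p$, and $P$ satisfies the countable chain condition if every set of pairwise incompatible elements is countable. For subsets $S,T$ of a partial order with the induced orders, $S$ is completely contained in $T$ if $S\subseteq T$, elements incompatible in $S$ are incompatible in $T$, and for every $t\in T$ there is $s\in S$ such that every $s'\in S$ with $s'\ge s$ is compatible with $t$ in $T$. $B(P)$ denotes the completion of $P$, i.e. the (up to isomorphism unique) complete Boolean algebra in which $P$ embeds, order-reversingly and with incompatible elements going to disjoint ones, as a dense subset. $\langle S\rangle^{cm}$ denotes the subalgebra completely generated by $S$. For Boolean algebras $B\le D$, $\pi(D/B)$ is the least cardinality of a set $A\subseteq D$ such that $A\cup B$ generates a dense subalgebra of $D$. A set $\mathbb C\subseteq[\kappa]^{\omega_1}=\{X\subseteq\kappa:|X|=\omega_1\}$ is club if every $S\in[\kappa]^{\omega_1}$ is included in some $X\in\mathbb C$, and the union of every nonempty $\subseteq$-chain of at most $\omega_1$ elements of $\mathbb C$ is in $\mathbb C$. Lemma. Let $\kappa\ge\omega_2$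 be a cardinal and, for every $X\subseteq\kappa$, let $P_X$ and $Q_X$ be separative partial orders such that: (a) every $P_X$ and every $Q_X$ satisfies the countable chain condition; (b) if $X\subseteq Y\subseteq\kappa$, then $P_X\subseteq P_Y$ and $P_X$ is completely contained in $P_Y$; similarly $Q_X$ is completely contained in $Q_Y$. Accordingly, write $A_X$ for the copy of $B(P_X)$ inside $A_\kappa=B(P_\kappa)$, i.e. the complete subalgebra of $B(P_\kappa)$ completely generated by $P_X$, in which $P_X$ is dense; similarly $B_X$ for the copy of $B(Q_X)$ inside $B_\kappa=B(Q_\kappa)$; (c) $P_X=\bigcup\{P_e: e\subseteq X\text{ finite}\}$ and $Q_X=\bigcup\{Q_e: e\subseteq X\text{ finite}\}$ for all $X\subseteq\kappa$; (d) $|P_X|\le|X|$ and $|Q_X|\le|X|$ for all infinite $X\subseteq\kappa$; (e) $A_{X\cup Y}=\langle A_X\cup A_Y\rangle^{cm}$ and $B_{X\cup Y}=\langle B_X\cup B_Y\rangle^{cm}$ for all $X,Y\subseteq\kappa$; (f) $\pi(A_{X\cup Y}/A_X)\le\omega$ for all $X\subseteq\kappa$ and all countable $Y\subseteq\kappa$.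 Assume that $B_\kappa$ is isomorphic to $A_\kappa$. Then there is a club subset $\mathbb C$ of $[\kappa]^{\omega_1}$ such that $\pi(B_{X\cup Y}/B_X)\le\omega$ for all $X\in\mathbb C$ and all countable $Y\subseteq\kappa$. -/

import Mathlib

open Cardinal

universe u

/-! ### Partial orders as notions of forcing

Throughout, `p ≤ q` means that the condition `q` is stronger than `p`. -/

/-- Two conditions are compatible if they have a common extension. -/
def Compat {P : Type u} [PartialOrder P] (p q : P) : Prop :=
  ∃ r, p ≤ r ∧ q ≤ r

/-- `P` is separative: if `p ≰ q` then some extension of `q` is incompatible with `p`. -/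
def Separative (P : Type u) [PartialOrder P] : Prop :=
  ∀ p q : P, ¬ p ≤ q → ∃ r, q ≤ r ∧ ¬ Compat r p

/-- The countable chain condition: every set of pairwise incompatible conditions is countable. -/
def CountableChainCondition (P : Type u) [PartialOrder P] : Prop :=
  ∀ S : Set P, S.Pairwise (fun p q => ¬ Compat p q) → S.Countable

/-- For subsets `S`, `T` of a partial order, each with the induced order: `S` is completely contained
in `T`, i.e. `S ⊆ T` and the inclusion is a complete embedding. Elements of `S` that are incompatible
in `S` are incompatible in `T`, and each `t ∈ T` has a reduction `s ∈ S`: every extension of `s`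
in `S` is compatible with `t` in `T`. -/
structure CompletelyContained {α : Type u} [PartialOrder α] (S T : Set α) : Prop where
  subset : S ⊆ T
  compat : ∀ p q : S, Compat (Set.inclusion subset p) (Set.inclusion subset q) → Compat p q
  reduction : ∀ t : T, ∃ s : S, ∀ s' : S, s ≤ s' → Compat (Set.inclusion subset s') t

/-! ### The completion of a partial order -/

/-- The completion `B(P)` of a partial order `P`: the regular open algebra of `P`. The open sets are
the subsets of `P` closed under extension, i.e. the lower sets of the dual order. -/
def Completion (P : Type u) [PartialOrder P] : Type u :=
  Heyting.Regular (LowerSet Pᵒᵈ)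

namespace Completion

variable {P : Type u} [PartialOrder P]

instance : BooleanAlgebra (Completion P) :=
  inferInstanceAs (BooleanAlgebra (Heyting.Regular (LowerSet Pᵒᵈ)))

noncomputable instance : CompleteBooleanAlgebra (Completion P) :=
  { (inferInstance : BooleanAlgebra (Completion P)) with
    sSup := (Heyting.Regular.gi.liftCompleteLattice
      (α := LowerSet Pᵒᵈ) (β := Heyting.Regular (LowerSet Pᵒᵈ))).sSup
    sInf := (Heyting.Regular.gi.liftCompleteLattice
      (α := LowerSet Pᵒᵈ) (β := Heyting.Regular (LowerSet Pᵒᵈ))).sInf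
    isLUB_sSup := (Heyting.Regular.gi.liftCompleteLattice
      (α := LowerSet Pᵒᵈ) (β := Heyting.Regular (LowerSet Pᵒᵈ))).isLUB_sSup
    isGLB_sInf := (Heyting.Regular.gi.liftCompleteLattice
      (α := LowerSet Pᵒᵈ) (β := Heyting.Regular (LowerSet Pᵒᵈ))).isGLB_sInf }

/-- The canonical order-reversing map `P → B(P)`, sending `p` to the regularization of the open set
of all extensions of `p`. -/
def of (p : P) : Completion P :=
  Heyting.Regular.toRegular (LowerSet.Iic (OrderDual.toDual p))

theorem of_le_iff {p : P} {a : Completion P} :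
    of p ≤ a ↔ OrderDual.toDual p ∈ (Heyting.Regular.val a : LowerSet Pᵒᵈ) :=
  (Heyting.Regular.gi.gc _ _).trans LowerSet.Iic_le

theorem of_anti {p q : P} (h : p ≤ q) : of q ≤ of p :=
  Heyting.Regular.toRegular.monotone (LowerSet.Iic_le.2 h)

/-- The image of `P` is dense in `B(P)`. -/
theorem exists_of_le {a : Completion P} (ha : a ≠ ⊥) : ∃ p : P, of p ≤ a := by
  by_contra! h
  refine ha (le_bot_iff.1 (Heyting.Regular.coe_le_coe.1 fun x hx => ?_))
  exact absurd (of_le_iff.2 hx) (h (OrderDual.ofDual x))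

theorem of_ne_bot (p : P) : of p ≠ ⊥ := by
  intro h
  have h1 := of_le_iff.1 (le_refl (of p))
  rw [h] at h1
  exact LowerSet.notMem_bot h1

/-- Compatibility in `P` is non-disjointness in `B(P)`. -/
theorem disjoint_of_iff {p q : P} : Disjoint (of p) (of q) ↔ ¬ Compat p q := by
  constructor
  · rintro h ⟨r, hp, hq⟩
    exact of_ne_bot r (le_bot_iff.1 (h (of_anti hp) (of_anti hq)))
  · intro h
    have h1 : Disjoint (LowerSet.Iic (OrderDual.toDual p)) (LowerSet.Iic (OrderDual.toDual q)) := by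
      rw [disjoint_iff_inf_le]
      rintro r ⟨hp, hq⟩
      exact (h ⟨OrderDual.ofDual r, hp, hq⟩).elim
    have h2 : of p ≤ (of q)ᶜ := by
      refine of_le_iff.2 ?_
      rw [← LowerSet.Iic_le]
      change _ ≤ (LowerSet.Iic (OrderDual.toDual q))ᶜᶜᶜ
      rw [compl_compl_compl]
      exact le_compl_iff_disjoint_right.2 h1
    exact le_compl_iff_disjoint_right.1 h2

/-- If `P` is separative, the map `P → B(P)` is an order-reversing embedding. -/
theorem of_le_of_iff (hP : Separative P) {p q : P} : of q ≤ of p ↔ p ≤ q := by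
  refine ⟨fun h => ?_, of_anti⟩
  by_contra hpq
  obtain ⟨r, hr, hrp⟩ := hP p q hpq
  have h1 := disjoint_of_iff.2 hrp
  exact of_ne_bot r (le_bot_iff.1 (h1 le_rfl ((of_anti hr).trans h)))

end Completion

/-! ### Completely generated subalgebras and relative π-weight -/

/-- The subalgebra `⟨S⟩^cm` of the complete Boolean algebra `D` completely generated by `S`: the least
subalgebra that includes `S` and is closed under arbitrary sums taken in `D` (hence, by complements,
under arbitrary products). -/
def completeClosure {D : Type u} [CompleteBooleanAlgebra D] (S : Set D) : BooleanSubalgebra D :=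
  sInf {L | S ⊆ L ∧ ∀ M : Set D, M ⊆ L → sSup M ∈ L}

/-- The relative π-weight `π(C/B)` of a subalgebra `C` over a subalgebra `B` (both inside `D`, and
used for `B ≤ C`): the least size of a set `A ⊆ C` such that `A ∪ B` generates a dense subalgebra
of `C`. -/
noncomputable def relPiWeight {D : Type u} [BooleanAlgebra D] (C B : BooleanSubalgebra D) :
    Cardinal.{u} :=
  sInf {c | ∃ A : Set D, A ⊆ C ∧ #A = c ∧
    ∀ d ∈ C, d ≠ ⊥ → ∃ x ∈ BooleanSubalgebra.closure (A ∪ (B : Set D)), x ≠ ⊥ ∧ x ≤ d}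

/-- For subsets `S ⊆ T` of a partial order, the subalgebra of `B(T)` completely generated by `S`.
If `S` is completely contained in `T`, this is the copy of `B(S)` inside `B(T)`; see
`exists_of_le_of_mem_subCompletion` and `nonempty_completion_orderIso`. -/
noncomputable def subCompletion {α : Type u} [PartialOrder α] (S T : Set α) : BooleanSubalgebra (Completion T) :=
  completeClosure (Completion.of '' {p : T | (p : α) ∈ S})

section

variable {α : Type u} [PartialOrder α] {S T : Set α}

theorem subset_completeClosure {D : Type u} [CompleteBooleanAlgebra D] (M : Set D) :
    M ⊆ completeClosure M := fun _ hx =>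
  BooleanSubalgebra.mem_sInf.2 fun _ hL => hL.1 hx

theorem sSup_mem_completeClosure {D : Type u} [CompleteBooleanAlgebra D] {M N : Set D}
    (h : N ⊆ completeClosure M) : sSup N ∈ completeClosure M :=
  BooleanSubalgebra.mem_sInf.2 fun L hL => hL.2 _ fun _ hx =>
    BooleanSubalgebra.mem_sInf.1 (h hx) L hL

/-- If `S` is completely contained in `T`, the elements of `subCompletion S T` are exactly the sums
of subsets of `S`. -/
theorem mem_subCompletion_iff (h : CompletelyContained S T) {a : Completion T} :
    a ∈ subCompletion S T ↔ ∃ M : Set T, (∀ p ∈ M, (p : α) ∈ S) ∧ a = sSup (Completion.of '' M) := by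
  constructor
  · intro ha
    have hcompl : ∀ M : Set T, (∀ p ∈ M, (p : α) ∈ S) → (sSup (Completion.of '' M))ᶜ =
        sSup (Completion.of '' {p : T | (p : α) ∈ S ∧ ∀ q ∈ M, ¬ Compat p q}) := by
      intro M hM
      apply le_antisymm
      · by_contra hcon
        obtain ⟨t, ht⟩ := Completion.exists_of_le (fun hb => hcon (sdiff_eq_bot_iff.1 hb))
        rw [sdiff_eq, le_inf_iff] at ht
        obtain ⟨s, hs⟩ := h.reduction t
        have hmem : Set.inclusion h.subset s ∈
            {p : T | (p : α) ∈ S ∧ ∀ q ∈ M, ¬ Compat p q} := by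
          refine ⟨s.2, fun q hq hc => ?_⟩
          obtain ⟨s', h1, h2⟩ := h.compat s ⟨q, hM q hq⟩ hc
          obtain ⟨r, h3, h4⟩ := hs s' h1
          have h5 : Completion.of r ≤ (sSup (Completion.of '' M))ᶜ := (Completion.of_anti h4).trans ht.1
          have h6 : Completion.of r ≤ sSup (Completion.of '' M) :=
            (Completion.of_anti (le_trans (show q ≤ Set.inclusion h.subset s' from h2) h3)).trans
              (le_sSup ⟨q, hq, rfl⟩)
          exact Completion.of_ne_bot r (le_bot_iff.1 (disjoint_compl_right h6 h5))
        obtain ⟨r, h3, h4⟩ := hs s le_rfl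
        have h5 := (Completion.of_anti h4).trans ht.2
        have h6 := (Completion.of_anti h3).trans (le_sSup (Set.mem_image_of_mem Completion.of hmem))
        exact Completion.of_ne_bot r (le_bot_iff.1 (disjoint_compl_right h6 h5))
      · refine sSup_le ?_
        rintro _ ⟨p, hp, rfl⟩
        rw [le_compl_iff_disjoint_right, disjoint_sSup_iff]
        rintro _ ⟨q, hq, rfl⟩
        exact Completion.disjoint_of_iff.2 (hp.2 q hq)
    have hS : ∀ N : Set (Completion T), (∀ a ∈ N, ∃ M : Set T, (∀ p ∈ M, (p : α) ∈ S) ∧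
        a = sSup (Completion.of '' M)) →
        ∃ M : Set T, (∀ p ∈ M, (p : α) ∈ S) ∧ sSup N = sSup (Completion.of '' M) := by
      intro N hN
      refine ⟨{p | (p : α) ∈ S ∧ Completion.of p ≤ sSup N}, fun p hp => hp.1, le_antisymm ?_ ?_⟩
      · refine sSup_le fun a haN => ?_
        obtain ⟨M, hM, rfl⟩ := hN a haN
        refine sSup_le ?_
        rintro _ ⟨p, hp, rfl⟩
        exact le_sSup ⟨p, ⟨hM p hp, (le_sSup (Set.mem_image_of_mem _ hp)).trans (le_sSup haN)⟩, rfl⟩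
      · refine sSup_le ?_
        rintro _ ⟨p, hp, rfl⟩
        exact hp.2
    have hsup : ∀ {a b : Completion T}, (∃ M : Set T, (∀ p ∈ M, (p : α) ∈ S) ∧
        a = sSup (Completion.of '' M)) → (∃ M : Set T, (∀ p ∈ M, (p : α) ∈ S) ∧
        b = sSup (Completion.of '' M)) → ∃ M : Set T, (∀ p ∈ M, (p : α) ∈ S) ∧
        a ⊔ b = sSup (Completion.of '' M) := by
      intro a b ha hb
      rw [← sSup_pair]
      refine hS _ ?_
      rintro c (rfl | rfl)
      exacts [ha, hb]
    have hc : ∀ {a : Completion T}, (∃ M : Set T, (∀ p ∈ M, (p : α) ∈ S) ∧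
        a = sSup (Completion.of '' M)) → ∃ M : Set T, (∀ p ∈ M, (p : α) ∈ S) ∧
        aᶜ = sSup (Completion.of '' M) := by
      rintro _ ⟨M, hM, rfl⟩
      exact ⟨_, fun p hp => hp.1, hcompl M hM⟩
    let L : BooleanSubalgebra (Completion T) :=
      { carrier := {a | ∃ M : Set T, (∀ p ∈ M, (p : α) ∈ S) ∧ a = sSup (Completion.of '' M)}
        supClosed' := fun _ ha _ hb => hsup ha hb
        infClosed' := fun a ha b hb => by
          have := hc (hsup (hc ha) (hc hb))
          rwa [← compl_inf, compl_compl] at this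
        compl_mem' := hc
        bot_mem' := ⟨∅, by simp, by simp⟩ }
    refine BooleanSubalgebra.mem_sInf.1 ha L ⟨?_, fun N hN => hS N hN⟩
    rintro _ ⟨p, hp, rfl⟩
    exact ⟨{p}, by simpa using hp, by simp⟩
  · rintro ⟨M, hM, rfl⟩
    refine sSup_mem_completeClosure ?_
    rintro _ ⟨p, hp, rfl⟩
    exact subset_completeClosure _ ⟨p, hM p hp, rfl⟩

/-- If `S` is completely contained in `T`, then `S` is dense in `subCompletion S T`. -/
theorem exists_of_le_of_mem_subCompletion (h : CompletelyContained S T) {a : Completion T}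
    (ha : a ∈ subCompletion S T) (hne : a ≠ ⊥) :
    ∃ p : T, (p : α) ∈ S ∧ Completion.of p ≤ a := by
  obtain ⟨M, hM, rfl⟩ := (mem_subCompletion_iff h).1 ha
  by_contra! hcon
  refine hne (le_bot_iff.1 (sSup_le ?_))
  rintro _ ⟨p, hp, rfl⟩
  exact (hcon p (hM p hp) (le_sSup ⟨p, hp, rfl⟩)).elim

/-- If `S` is completely contained in `T`, then `subCompletion S T` is isomorphic to `B(S)`. -/
theorem nonempty_completion_orderIso (h : CompletelyContained S T) :
    Nonempty (Completion S ≃o subCompletion S T) := by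
  have hle : ∀ {P : Type u} [PartialOrder P] {p : P} {a : Completion P},
      (∀ q, p ≤ q → ¬ Disjoint (Completion.of q) a) → Completion.of p ≤ a := by
    intro P _ p a hp
    by_contra hcon
    obtain ⟨t, ht⟩ := Completion.exists_of_le (fun hb => hcon (sdiff_eq_bot_iff.1 hb))
    rw [sdiff_eq, le_inf_iff] at ht
    have : Compat p t := by
      by_contra hc
      exact Completion.of_ne_bot t
        (le_bot_iff.1 ((Completion.disjoint_of_iff.2 hc) ht.1 le_rfl))
    obtain ⟨r, h1, h2⟩ := this
    exact hp r h1 (le_compl_iff_disjoint_right.1 ((Completion.of_anti h2).trans ht.2))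
  let i : S → T := Set.inclusion h.subset
  have hsame : ∀ {M : Set S} {p : S}, Completion.of p ≤ sSup (Completion.of '' M) ↔
      Completion.of (i p) ≤ sSup (Completion.of '' (i '' M)) := by
    intro M p
    constructor
    · intro hp
      refine hle fun q hq hd => ?_
      obtain ⟨s, hs⟩ := h.reduction q
      obtain ⟨r, h1, h2⟩ := hs s le_rfl
      obtain ⟨s', h3, h4⟩ := h.compat s p ⟨r, h1, hq.trans h2⟩
      have h5 : ¬ Disjoint (Completion.of s') (sSup (Completion.of '' M)) := fun hd' =>
        Completion.of_ne_bot s' (le_bot_iff.1 (hd' le_rfl ((Completion.of_anti h4).trans hp)))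
      rw [disjoint_sSup_iff] at h5
      push Not at h5
      obtain ⟨_, ⟨m, hm, rfl⟩, h6⟩ := h5
      rw [Completion.disjoint_of_iff, not_not] at h6
      obtain ⟨w, h7, h8⟩ := h6
      obtain ⟨x, h9, h10⟩ := hs w (h3.trans h7)
      have h11 : i m ≤ x := le_trans (show i m ≤ i w from h8) h9
      exact Completion.of_ne_bot x (le_bot_iff.1 (hd (Completion.of_anti h10)
        ((Completion.of_anti h11).trans (le_sSup ⟨_, ⟨m, hm, rfl⟩, rfl⟩))))
    · intro hp
      refine hle fun q hq hd => ?_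
      have h5 : ¬ Disjoint (Completion.of (i q)) (sSup (Completion.of '' (i '' M))) := fun hd' =>
        Completion.of_ne_bot (i q) (le_bot_iff.1 (hd' le_rfl
          ((Completion.of_anti (show i p ≤ i q from hq)).trans hp)))
      rw [disjoint_sSup_iff] at h5
      push Not at h5
      obtain ⟨_, ⟨_, ⟨m, hm, rfl⟩, rfl⟩, h6⟩ := h5
      rw [Completion.disjoint_of_iff, not_not] at h6
      obtain ⟨w, h7, h8⟩ := h.compat _ _ h6
      exact Completion.of_ne_bot w (le_bot_iff.1 (hd (Completion.of_anti h7)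
        ((Completion.of_anti h8).trans (le_sSup ⟨m, hm, rfl⟩))))
  have hsum : ∀ a : Completion S, a = sSup (Completion.of '' {p | Completion.of p ≤ a}) := by
    intro a
    refine le_antisymm ?_ (sSup_le (by rintro _ ⟨p, hp, rfl⟩; exact hp))
    by_contra hcon
    obtain ⟨t, ht⟩ := Completion.exists_of_le (fun hb => hcon (sdiff_eq_bot_iff.1 hb))
    rw [sdiff_eq, le_inf_iff] at ht
    exact Completion.of_ne_bot t (le_bot_iff.1
      (disjoint_compl_right
        (le_sSup (Set.mem_image_of_mem Completion.of (show t ∈ {p | _ ≤ a} from ht.1))) ht.2))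
  let F : Completion S → subCompletion S T := fun a =>
    ⟨sSup (Completion.of '' (i '' {p | Completion.of p ≤ a})),
      (mem_subCompletion_iff h).2 ⟨_, by rintro _ ⟨p, -, rfl⟩; exact p.2, rfl⟩⟩
  have hF : ∀ a p, Completion.of p ≤ a ↔ Completion.of (i p) ≤ (F a : Completion T) := by
    intro a p
    conv_lhs => rw [hsum a]
    exact hsame
  have hFle : ∀ a b, F a ≤ F b ↔ a ≤ b := by
    intro a b
    constructor
    · intro hab
      rw [hsum a]
      refine sSup_le ?_
      rintro _ ⟨p, hp, rfl⟩
      exact (hF b p).2 (((hF a p).1 hp).trans hab)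
    · intro hab
      change sSup (Completion.of '' (i '' {p | Completion.of p ≤ a})) ≤
        sSup (Completion.of '' (i '' {p | Completion.of p ≤ b}))
      exact sSup_le_sSup (Set.image_mono (Set.image_mono fun p hp => le_trans hp hab))
  have hsurj : Function.Surjective F := by
    rintro ⟨b, hb⟩
    obtain ⟨M, hM, rfl⟩ := (mem_subCompletion_iff h).1 hb
    refine ⟨sSup (Completion.of '' (i ⁻¹' M)), Subtype.ext (le_antisymm ?_ ?_)⟩
    · refine sSup_le ?_
      rintro _ ⟨_, ⟨p, hp, rfl⟩, rfl⟩
      exact (hsame.1 hp).trans (sSup_le_sSup (Set.image_mono (Set.image_preimage_subset _ _)))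
    · refine sSup_le ?_
      rintro _ ⟨p, hp, rfl⟩
      have hp' : (⟨p, hM p hp⟩ : S) ∈ i ⁻¹' M := hp
      exact le_sSup ⟨p, ⟨⟨p, hM p hp⟩, le_sSup (Set.mem_image_of_mem Completion.of hp'), rfl⟩, rfl⟩
  exact ⟨(RelIso.ofSurjective (OrderEmbedding.ofMapLEIff F hFle) hsurj)⟩

end

/-! ### Clubs in `[κ]^μ` -/

/-- `C` is a club subset of `[κ]^μ`: it consists of subsets of `κ` of size `μ`, it is unbounded, and it
is closed under unions of nonempty chains of length at most `μ`. -/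
structure IsClubIn {κ : Type u} (μ : Cardinal.{u}) (C : Set (Set κ)) : Prop where
  card : ∀ X ∈ C, #X = μ
  unbounded : ∀ S : Set κ, #S = μ → ∃ X ∈ C, S ⊆ X
  closed : ∀ K : Set (Set κ), K ⊆ C → K.Nonempty → IsChain (· ⊆ ·) K → #K ≤ μ → ⋃₀ K ∈ C

/-! ### Relative π-weight and dense subalgebras -/

/-! Fix an isomorphism `φ` from B(Q_κ) to B(P_κ). By ccc and finite supports, every element of
either completion has a countable support (`exists_countable_mem_subCompletion`). A closing-off
argument therefore shows that the sets X of size ℵ₁ with `φ` mapping B_X onto A_X form a club.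

For such X and countable Y, the images of the conditions in Q_Y have a common countable support Z,
so by (e) the image of B_{X∪Y} lies between A_X and A_{X∪Z}. By (f), A_{X∪Z} has countable π-weight
over A_X. This passes down to the intermediate algebra, since that algebra is closed under sums and
so admits an upward projection (`relPiWeight_le_aleph0_of_orderIso`). -/

/-- Every nonzero element of the subalgebra generated by `A ∪ B` is met, below itself, by a product of
a finite product of elements of `A` and their complements with an element of `B`. -/
theorem exists_inf_le_of_mem_closure_union {D : Type u} [BooleanAlgebra D] {A : Set D}
    {B : BooleanSubalgebra D} {x : D} (hx : x ∈ BooleanSubalgebra.closure (A ∪ (B : Set D)))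
    (hne : x ≠ ⊥) :
    ∃ s : Finset D, (s : Set D) ⊆ A ∪ compl '' A ∧ ∃ b ∈ B,
      s.inf id ⊓ b ≤ x ∧ s.inf id ⊓ b ≠ ⊥ := by
  classical
  -- The test element `d` makes the induction work: for a meet, the piece below `x` is chosen to
  -- meet `d ⊓ y`, and the piece below `y` is then chosen to meet the first piece.
  let p : D → Prop := fun x => ∀ d, d ⊓ x ≠ ⊥ → ∃ s : Finset D, (s : Set D) ⊆ A ∪ compl '' A ∧
    ∃ b ∈ B, s.inf id ⊓ b ≤ x ∧ d ⊓ (s.inf id ⊓ b) ≠ ⊥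
  have hlit : ∀ a ∈ A ∪ compl '' A, p a := fun a ha d hd =>
    ⟨{a}, by simpa using ha, ⊤, BooleanSubalgebra.top_mem, by simp, by simpa using hd⟩
  have hB : ∀ b ∈ B, p b := fun b hb d hd =>
    ⟨∅, by simp, b, hb, by simp, by simpa using hd⟩
  have hsup : ∀ x y, p x → p y → p (x ⊔ y) := by
    intro x y hpx hpy d hd
    rw [inf_sup_left] at hd
    by_cases h : d ⊓ x = ⊥
    · obtain ⟨s, hs, b, hb, hle, h0⟩ := hpy d (fun h' => hd (by rw [h, h', sup_idem]))
      exact ⟨s, hs, b, hb, hle.trans le_sup_right, h0⟩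
    · obtain ⟨s, hs, b, hb, hle, h0⟩ := hpx d h
      exact ⟨s, hs, b, hb, hle.trans le_sup_left, h0⟩
  have hinf : ∀ x y, p x → p y → p (x ⊓ y) := by
    intro x y hpx hpy d hd
    obtain ⟨s, hs, b, hb, hle, h0⟩ := hpx (d ⊓ y)
      (by rwa [inf_assoc, inf_comm y x])
    obtain ⟨t, ht, c, hc, hle', h0'⟩ := hpy (d ⊓ (s.inf id ⊓ b))
      (by rwa [inf_right_comm])
    have heq : (s ∪ t).inf id ⊓ (b ⊓ c) = (s.inf id ⊓ b) ⊓ (t.inf id ⊓ c) := by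
      rw [Finset.inf_union, inf_inf_inf_comm]
    refine ⟨s ∪ t, by simpa using ⟨hs, ht⟩, b ⊓ c, BooleanSubalgebra.inf_mem hb hc, ?_, ?_⟩
    · rw [heq]
      exact inf_le_inf hle hle'
    · rwa [heq, ← inf_assoc]
  -- `p` is not visibly preserved by complements, so `x` and `xᶜ` are treated together; De Morgan
  -- turns complements of joins into meets.
  have key : p x ∧ p xᶜ := by
    clear hne
    induction hx using BooleanSubalgebra.closure_bot_sup_induction with
    | mem x hx =>
      rcases hx with hx | hx
      · exact ⟨hlit x (Or.inl hx), hlit _ (Or.inr ⟨x, hx, rfl⟩)⟩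
      · exact ⟨hB x hx, hB _ (BooleanSubalgebra.compl_mem hx)⟩
    | bot => exact ⟨hB _ BooleanSubalgebra.bot_mem, by simpa using hB _ BooleanSubalgebra.top_mem⟩
    | sup x hx y hy ihx ihy =>
      exact ⟨hsup _ _ ihx.1 ihy.1, by
        rw [compl_sup]
        exact hinf _ _ ihx.2 ihy.2⟩
    | compl x hx ih => exact ⟨ih.2, by rw [compl_compl]; exact ih.1⟩
  obtain ⟨s, hs, b, hb, hle, h0⟩ := key.1 ⊤ (by simpa using hne)
  exact ⟨s, hs, b, hb, hle, by simpa using h0⟩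

/-- The infimum is attained, because cardinals are well-ordered and `C` itself is an admissible
generating set. -/
theorem relPiWeight_le_aleph0_iff {D : Type u} [BooleanAlgebra D] {C B : BooleanSubalgebra D} :
    relPiWeight C B ≤ ℵ₀ ↔ ∃ A : Set D, A ⊆ C ∧ A.Countable ∧
      ∀ d ∈ C, d ≠ ⊥ → ∃ x ∈ BooleanSubalgebra.closure (A ∪ (B : Set D)), x ≠ ⊥ ∧ x ≤ d := by
  constructor
  · intro h
    have hmem := csInf_mem (s := {c | ∃ A : Set D, A ⊆ C ∧ #A = c ∧
      ∀ d ∈ C, d ≠ ⊥ → ∃ x ∈ BooleanSubalgebra.closure (A ∪ (B : Set D)), x ≠ ⊥ ∧ x ≤ d})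
      ⟨#C, C, subset_rfl, rfl, fun d hd hne =>
        ⟨d, BooleanSubalgebra.mem_closure_of_mem (Or.inl hd), hne, le_rfl⟩⟩
    obtain ⟨A, hA, hcard, hdense⟩ := hmem
    refine ⟨A, hA, ?_, hdense⟩
    rw [← le_aleph0_iff_set_countable, hcard]
    exact h
  · rintro ⟨A, hA, hcount, hdense⟩
    exact le_trans (csInf_le' ⟨A, hA, rfl, hdense⟩) (le_aleph0_iff_set_countable.2 hcount)

/-- Countable relative π-weight passes from `E` over `B` to an intermediate subalgebra closed under
arbitrary sums, by projecting upwards. The intermediate subalgebra lives in an isomorphic copy. -/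
theorem relPiWeight_le_aleph0_of_orderIso {D D' : Type u} [CompleteBooleanAlgebra D]
    [CompleteBooleanAlgebra D'] (φ : D' ≃o D) {B' C' : BooleanSubalgebra D'}
    {B E : BooleanSubalgebra D} (hBC : B' ≤ C') (hC : ∀ M : Set D', M ⊆ C' → sSup M ∈ C')
    (hB : ∀ b ∈ B, φ.symm b ∈ B') (hE : ∀ c ∈ C', φ c ∈ E) (h : relPiWeight E B ≤ ℵ₀) :
    relPiWeight C' B' ≤ ℵ₀ := by
  obtain ⟨A, -, hcount, hdense⟩ := relPiWeight_le_aleph0_iff.1 h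
  -- Upward projection: the least element of `C'` whose image lies above `d`. It belongs to `C'`
  -- because `C'` is closed under sums, hence under products.
  let π : D → D' := fun d => sInf {c | c ∈ C' ∧ d ≤ φ c}
  have hπmem : ∀ d, π d ∈ C' := by
    intro d
    rw [← BooleanSubalgebra.compl_mem_iff, compl_sInf']
    refine hC _ ?_
    rintro _ ⟨c, hc, rfl⟩
    exact BooleanSubalgebra.compl_mem hc.1
  have hπ : ∀ d, d ≤ φ (π d) := by
    intro d
    rw [φ.map_sInf]
    exact le_iInf₂ fun c hc => hc.2
  -- Projection commutes with meets by elements of `C'`; the implication `b ⇨ c` again lies in `C'`,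
  -- so it competes in the infimum defining `π d`.
  have hπle : ∀ d, ∀ b ∈ C', ∀ c ∈ C', d ⊓ φ b ≤ φ c → π d ⊓ b ≤ c := by
    intro d b hb c hc hle
    rw [← le_himp_iff] at hle ⊢
    exact sInf_le ⟨BooleanSubalgebra.himp_mem hb hc, by rwa [map_himp]⟩
  -- The projections of finite products of literals from `A` suffice. Projecting the generators
  -- alone would not, since `π` need not preserve meets.
  refine relPiWeight_le_aleph0_iff.2
    ⟨(fun s : Finset D => π (s.inf id)) '' {s | (s : Set D) ⊆ A ∪ compl '' A}, ?_, ?_, ?_⟩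
  · rintro _ ⟨s, -, rfl⟩
    exact hπmem _
  · exact (((Set.countable_ofPred_finite_subset (hcount.union (hcount.image _))).preimage
      Finset.coe_injective).mono fun s hs => And.intro s.finite_toSet hs).image _
  · intro c hc hne
    obtain ⟨x, hx, hx0, hxc⟩ := hdense (φ c) (hE c hc) (by simpa using hne)
    obtain ⟨s, hs, b, hb, hle, h0⟩ := exists_inf_le_of_mem_closure_union hx hx0
    have hb' := hB b hb
    refine ⟨π (s.inf id) ⊓ φ.symm b, BooleanSubalgebra.inf_mem
      (BooleanSubalgebra.mem_closure_of_mem (Or.inl ⟨s, hs, rfl⟩))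
      (BooleanSubalgebra.mem_closure_of_mem (Or.inr hb')), fun hbot => h0 ?_, ?_⟩
    · rw [← le_bot_iff, ← φ.map_bot, ← hbot, φ.map_inf, φ.apply_symm_apply]
      exact inf_le_inf_right _ (hπ _)
    · refine hπle _ _ (hBC hb') _ hc ?_
      rw [φ.apply_symm_apply]
      exact hle.trans hxc

/-- The preimage of `L` under `φ` is a sum-closed subalgebra including `S`. -/
theorem map_mem_of_mem_completeClosure {D D' : Type u} [CompleteBooleanAlgebra D]
    [CompleteBooleanAlgebra D'] (φ : D' ≃o D) {S : Set D'} {L : BooleanSubalgebra D}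
    (hL : ∀ M : Set D, M ⊆ L → sSup M ∈ L) (hS : ∀ x ∈ S, φ x ∈ L) {x : D'}
    (hx : x ∈ completeClosure S) : φ x ∈ L := by
  refine BooleanSubalgebra.mem_sInf.1 hx (L.comap (φ : BoundedLatticeHom D' D)) ⟨hS, ?_⟩
  intro M hM
  change φ (sSup M) ∈ L
  rw [φ.map_sSup, ← sSup_image]
  refine hL _ ?_
  rintro _ ⟨y, hy, rfl⟩
  exact hM hy

/-! ### Supports of elements of the completion -/

/-- A family of sets with finite supports commutes with directed unions. -/
theorem exists_mem_of_mem_sUnion {α κ : Type u} {P : Set κ → Set α} (hmono : Monotone P)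
    (hfin : ∀ X, P X = ⋃ e ∈ {e : Set κ | e ⊆ X ∧ e.Finite}, P e) {K : Set (Set κ)}
    (hne : K.Nonempty) (hK : DirectedOn (· ⊆ ·) K) {p : α} (hp : p ∈ P (⋃₀ K)) :
    ∃ X ∈ K, p ∈ P X := by
  rw [hfin] at hp
  simp only [Set.mem_iUnion] at hp
  obtain ⟨e, ⟨hesub, hefin⟩, hpe⟩ := hp
  obtain ⟨X, hX, heX⟩ := hK.exists_mem_subset_of_finite_of_subset_sUnion hne hefin hesub
  exact ⟨X, hX, hmono heX hpe⟩

section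

variable {α : Type u} [PartialOrder α]

theorem subCompletion_mono {S S' T : Set α} (h : S ⊆ S') :
    subCompletion S T ≤ subCompletion S' T := by
  intro x hx
  refine map_mem_of_mem_completeClosure (OrderIso.refl _)
    (fun _ hM => sSup_mem_completeClosure hM) ?_ hx
  rintro _ ⟨p, hp, rfl⟩
  exact subset_completeClosure _ ⟨p, h hp, rfl⟩

/-- Under the countable chain condition every element of `B(P)` is a sum of countably many conditions. -/
theorem exists_countable_eq_sSup_of {P : Type u} [PartialOrder P] (hP : CountableChainCondition P)
    (a : Completion P) : ∃ M : Set P, M.Countable ∧ a = sSup (Completion.of '' M) := by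
  -- A maximal antichain of conditions below `a`; a condition below `a` and disjoint from its sum
  -- would extend it.
  obtain ⟨M, hM⟩ := zorn_subset
    {M : Set P | M.Pairwise (fun p q => ¬ Compat p q) ∧ ∀ p ∈ M, Completion.of p ≤ a} (by
      intro c hc hchain
      refine ⟨⋃₀ c, ⟨?_, ?_⟩, fun s hs => Set.subset_sUnion_of_mem hs⟩
      · exact (Set.pairwise_sUnion hchain.directedOn).2 fun s hs => (hc hs).1
      · rintro p ⟨s, hs, hp⟩
        exact (hc hs).2 p hp)
  refine ⟨M, hP M hM.prop.1, le_antisymm ?_ (sSup_le ?_)⟩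
  · by_contra hcon
    obtain ⟨t, ht⟩ := Completion.exists_of_le (fun hb => hcon (sdiff_eq_bot_iff.1 hb))
    rw [sdiff_eq, le_inf_iff] at ht
    have hdisj : ∀ q ∈ M, ¬ Compat t q := fun q hq =>
      Completion.disjoint_of_iff.1 (le_compl_iff_disjoint_right.1 (ht.2.trans
        (compl_le_compl (le_sSup (Set.mem_image_of_mem _ hq)))))
    have hins : insert t M ∈ {M : Set P | M.Pairwise (fun p q => ¬ Compat p q) ∧
        ∀ p ∈ M, Completion.of p ≤ a} := by
      refine ⟨hM.prop.1.insert fun q hq _ => ⟨hdisj q hq, ?_⟩, ?_⟩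
      · rintro ⟨r, h1, h2⟩
        exact hdisj q hq ⟨r, h2, h1⟩
      · rintro p (rfl | hp)
        exacts [ht.1, hM.prop.2 p hp]
    have htM : t ∈ M := hM.le_of_ge hins (Set.subset_insert t M) (Set.mem_insert t M)
    exact hdisj t htM ⟨t, le_rfl, le_rfl⟩
  · rintro _ ⟨p, hp, rfl⟩
    exact hM.prop.2 p hp

variable {κ : Type u} {P : Set κ → Set α}

/-- Write the element as a countable sum of conditions and take the union of their finite supports.
-/
theorem exists_countable_mem_subCompletion (hP : CountableChainCondition (P Set.univ))
    (hmono : Monotone P) (hfin : ∀ X, P X = ⋃ e ∈ {e : Set κ | e ⊆ X ∧ e.Finite}, P e)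
    (a : Completion (P Set.univ)) :
    ∃ Y : Set κ, Y.Countable ∧ a ∈ subCompletion (P Y) (P Set.univ) := by
  obtain ⟨M, hM, rfl⟩ := exists_countable_eq_sSup_of hP a
  have hsupp : ∀ p : P Set.univ, ∃ e : Set κ, e.Finite ∧ (p : α) ∈ P e := by
    intro p
    have hp : (p : α) ∈ ⋃ e ∈ {e : Set κ | e ⊆ Set.univ ∧ e.Finite}, P e := by
      rw [← hfin]
      exact p.2
    simp only [Set.mem_iUnion] at hp
    obtain ⟨e, he, hpe⟩ := hp
    exact ⟨e, he.2, hpe⟩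
  choose e hefin he using hsupp
  refine ⟨⋃ p ∈ M, e p, hM.biUnion fun p _ => (hefin p).countable, sSup_mem_completeClosure ?_⟩
  rintro _ ⟨p, hp, rfl⟩
  exact subset_completeClosure _ ⟨p, hmono (Set.subset_biUnion_of_mem hp) (he p), rfl⟩

/-! ### Index sets closed under an isomorphism of completions -/

variable {β : Type u} [PartialOrder β] {Q : Set κ → Set β}

/-- The map `φ` sends the conditions supported by `X` to elements supported by `X`. -/
def MapsSupport (P : Set κ → Set α) (Q : Set κ → Set β)
    (φ : Completion (P Set.univ) ≃o Completion (Q Set.univ)) (X : Set κ) : Prop :=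
  ∀ p : P Set.univ, (p : α) ∈ P X → φ (Completion.of p) ∈ subCompletion (Q X) (Q Set.univ)

variable {φ : Completion (P Set.univ) ≃o Completion (Q Set.univ)}

theorem MapsSupport.map_mem {X : Set κ} (h : MapsSupport P Q φ X)
    {a : Completion (P Set.univ)} (ha : a ∈ subCompletion (P X) (P Set.univ)) :
    φ a ∈ subCompletion (Q X) (Q Set.univ) := by
  refine map_mem_of_mem_completeClosure φ (fun _ hM => sSup_mem_completeClosure hM) ?_ ha
  rintro _ ⟨p, hp, rfl⟩
  exact h p hp

theorem MapsSupport.sUnion (hP : Monotone P) (hQ : Monotone Q)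
    (hPfin : ∀ X, P X = ⋃ e ∈ {e : Set κ | e ⊆ X ∧ e.Finite}, P e) {K : Set (Set κ)}
    (hne : K.Nonempty) (hK : DirectedOn (· ⊆ ·) K) (h : ∀ X ∈ K, MapsSupport P Q φ X) :
    MapsSupport P Q φ (⋃₀ K) := by
  intro p hp
  obtain ⟨X, hX, hpX⟩ := exists_mem_of_mem_sUnion hP hPfin hne hK hp
  exact subCompletion_mono (hQ (Set.subset_sUnion_of_mem hX)) (h X hX p hpX)

/-- The images under `φ` of the conditions in `P X` are jointly supported by a set no larger than
`P X`, up to `ℵ₀`. -/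
theorem exists_superset_map_mem (hQ : Monotone Q)
    (hQccc : CountableChainCondition (Q Set.univ))
    (hQfin : ∀ X, Q X = ⋃ e ∈ {e : Set κ | e ⊆ X ∧ e.Finite}, Q e)
    (φ : Completion (P Set.univ) ≃o Completion (Q Set.univ)) {X : Set κ} {c : Cardinal.{u}}
    (hc : ℵ₀ ≤ c) (hX : #(P X) ≤ c) : ∃ Y : Set κ, #Y ≤ c ∧
      ∀ p : P Set.univ, (p : α) ∈ P X → φ (Completion.of p) ∈ subCompletion (Q Y) (Q Set.univ) := by
  choose g hg hmem using fun p : P Set.univ =>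
    exists_countable_mem_subCompletion hQccc hQ hQfin (φ (Completion.of p))
  refine ⟨⋃ p ∈ {p : P Set.univ | (p : α) ∈ P X}, g p, ?_, fun p hp =>
    subCompletion_mono (hQ (Set.subset_biUnion_of_mem (u := g) hp)) (hmem p)⟩
  have hcard : #{p : P Set.univ | (p : α) ∈ P X} ≤ c := by
    refine le_trans (mk_le_of_injective (f := fun p => (⟨p.1.1, p.2⟩ : P X)) ?_) hX
    rintro ⟨⟨p, hp⟩, hp'⟩ ⟨⟨q, hq⟩, hq'⟩ h
    simpa using h
  refine (mk_biUnion_le _ _).trans (mul_le_of_le hc hcard (ciSup_le' fun p => ?_))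
  exact (le_aleph0_iff_set_countable.2 (hg p)).trans hc

end

/-! ### The club of index sets respected by the isomorphism -/

theorem lemma3p1
    {κ : Type u} (hκ : ℵ_ 2 ≤ #κ) {α β : Type u} [PartialOrder α] [PartialOrder β]
    (P : Set κ → Set α) (Q : Set κ → Set β)
    (hPsep : ∀ X, Separative (P X)) (hQsep : ∀ X, Separative (Q X))
    (hPccc : ∀ X, CountableChainCondition (P X))
    (hQccc : ∀ X, CountableChainCondition (Q X))
    (hPsub : ∀ X Y, X ⊆ Y → CompletelyContained (P X) (P Y))
    (hQsub : ∀ X Y, X ⊆ Y → CompletelyContained (Q X) (Q Y))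
    (hPfin : ∀ X, P X = ⋃ e ∈ {e : Set κ | e ⊆ X ∧ e.Finite}, P e)
    (hQfin : ∀ X, Q X = ⋃ e ∈ {e : Set κ | e ⊆ X ∧ e.Finite}, Q e)
    (hPcard : ∀ X : Set κ, X.Infinite → #(P X) ≤ #X)
    (hQcard : ∀ X : Set κ, X.Infinite → #(Q X) ≤ #X)
    (A : Set κ → BooleanSubalgebra (Completion (P Set.univ)))
    (hA : ∀ X, A X = subCompletion (P X) (P Set.univ))
    (B : Set κ → BooleanSubalgebra (Completion (Q Set.univ)))
    (hB : ∀ X, B X = subCompletion (Q X) (Q Set.univ))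
    (hAgen : ∀ X Y, A (X ∪ Y) = completeClosure ((A X : Set (Completion (P Set.univ))) ∪ A Y))
    (hBgen : ∀ X Y, B (X ∪ Y) = completeClosure ((B X : Set (Completion (Q Set.univ))) ∪ B Y))
    (hApi : ∀ X Y : Set κ, Y.Countable → relPiWeight (A (X ∪ Y)) (A X) ≤ ℵ₀)
    (hiso : Nonempty (Completion (Q Set.univ) ≃o Completion (P Set.univ))) :
    ∃ C : Set (Set κ), IsClubIn (ℵ_ 1) C ∧
      ∀ X ∈ C, ∀ Y : Set κ, Y.Countable → relPiWeight (B (X ∪ Y)) (B X) ≤ ℵ₀ := by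
  obtain ⟨φ⟩ := hiso
  have hP : Monotone P := fun X Y h => (hPsub X Y h).subset
  have hQ : Monotone Q := fun X Y h => (hQsub X Y h).subset
  have hω : ℵ₀ ≤ ℵ_ 1 := aleph0_le_aleph 1
  have hcompl : ∀ X, ∀ M : Set (Completion (P Set.univ)), M ⊆ A X → sSup M ∈ A X := by
    intro X M hM
    rw [hA] at hM ⊢
    exact sSup_mem_completeClosure hM
  -- Requiring support preservation in both directions makes `φ` carry `B X` exactly onto `A X`.
  refine ⟨{X | #X = ℵ_ 1 ∧ MapsSupport Q P φ X ∧ MapsSupport P Q φ.symm X},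
    ⟨fun X hX => hX.1, ?_, ?_⟩, ?_⟩
  · intro S hS
    have hstep : ∀ X : {X : Set κ // #X = ℵ_ 1}, ∃ Y : {X : Set κ // #X = ℵ_ 1}, X.1 ⊆ Y.1 ∧
        (∀ q : Q Set.univ, (q : β) ∈ Q X.1 →
          φ (Completion.of q) ∈ subCompletion (P Y.1) (P Set.univ)) ∧
        ∀ p : P Set.univ, (p : α) ∈ P X.1 →
          φ.symm (Completion.of p) ∈ subCompletion (Q Y.1) (Q Set.univ) := by
      rintro ⟨X, hX⟩
      have hinf : X.Infinite := by
        rw [← Set.infinite_coe_iff, infinite_iff, hX]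
        exact hω
      obtain ⟨Y, hYc, hY⟩ := exists_superset_map_mem hP (hPccc _) hPfin φ hω
        ((hQcard X hinf).trans hX.le)
      obtain ⟨Z, hZc, hZ⟩ := exists_superset_map_mem hQ (hQccc _) hQfin φ.symm hω
        ((hPcard X hinf).trans hX.le)
      refine ⟨⟨X ∪ (Y ∪ Z), le_antisymm ?_ ?_⟩, Set.subset_union_left, ?_, ?_⟩
      · exact (mk_union_le _ _).trans (add_le_of_le hω hX.le
          ((mk_union_le _ _).trans (add_le_of_le hω hYc hZc)))
      · exact hX.ge.trans (mk_le_mk_of_subset Set.subset_union_left)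
      · exact fun q hq => subCompletion_mono
          (hP (Set.subset_union_left.trans Set.subset_union_right)) (hY q hq)
      · exact fun p hp => subCompletion_mono
          (hQ (Set.subset_union_right.trans Set.subset_union_right)) (hZ p hp)
    choose F hF hFφ hFψ using hstep
    -- Closing off in ω steps: each condition over the union already appears at a stage n, and its
    -- image is supported by stage n + 1.
    let X : ℕ → {X : Set κ // #X = ℵ_ 1} := fun n => F^[n] ⟨S, hS⟩
    have hsucc : ∀ n, X (n + 1) = F (X n) := fun n => Function.iterate_succ_apply' F n _
    have hXmono : Monotone fun n => (X n).1 := monotone_nat_of_le_succ fun n => by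
      rw [hsucc]
      exact hF _
    have hle : ∀ n, (X n).1 ⊆ ⋃₀ Set.range fun n => (X n).1 := fun n =>
      Set.subset_sUnion_of_mem ⟨n, rfl⟩
    have hdir : DirectedOn (· ⊆ ·) (Set.range fun n => (X n).1) :=
      directedOn_range.2 hXmono.directed_le
    refine ⟨⋃₀ Set.range fun n => (X n).1, ⟨le_antisymm ?_ ?_, ?_, ?_⟩, hle 0⟩
    · refine (mk_sUnion_le _).trans (mul_le_of_le hω ?_ (ciSup_le' ?_))
      · exact (le_aleph0_iff_set_countable.2 (Set.countable_range _)).trans hω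
      · rintro ⟨_, n, rfl⟩
        exact (X n).2.le
    · exact hS.ge.trans (mk_le_mk_of_subset (hle 0))
    · intro q hq
      obtain ⟨_, ⟨n, rfl⟩, hqn⟩ :=
        exists_mem_of_mem_sUnion hQ hQfin (Set.range_nonempty _) hdir hq
      refine subCompletion_mono (hP (hle (n + 1))) ?_
      rw [hsucc]
      exact hFφ _ q hqn
    · intro p hp
      obtain ⟨_, ⟨n, rfl⟩, hpn⟩ :=
        exists_mem_of_mem_sUnion hP hPfin (Set.range_nonempty _) hdir hp
      refine subCompletion_mono (hQ (hle (n + 1))) ?_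
      rw [hsucc]
      exact hFψ _ p hpn
  · intro K hK hne hchain hcard
    refine ⟨le_antisymm ?_ ?_, ?_, ?_⟩
    · exact (mk_sUnion_le _).trans
        (mul_le_of_le hω hcard (ciSup_le' fun X => (hK X.2).1.le))
    · obtain ⟨X, hX⟩ := hne
      exact (hK hX).1.ge.trans (mk_le_mk_of_subset (Set.subset_sUnion_of_mem hX))
    · exact MapsSupport.sUnion hQ hP hQfin hne hchain.directedOn fun X hX => (hK hX).2.1
    · exact MapsSupport.sUnion hP hQ hPfin hne hchain.directedOn fun X hX => (hK hX).2.2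
  · rintro X ⟨-, hφ, hψ⟩ Y hY
    have : Infinite κ := infinite_iff.2 ((aleph0_le_aleph 2).trans hκ)
    -- Hypothesis (d) bounds only infinite index sets, so the possibly finite `Y` is padded with a
    -- countably infinite set.
    let N : Set κ := Set.range (Infinite.natEmbedding κ)
    have hQY : #(Q Y) ≤ ℵ₀ := by
      have hinf : (Y ∪ N).Infinite :=
        (Set.infinite_range_of_injective (Infinite.natEmbedding κ).injective).mono
          Set.subset_union_right
      exact (mk_le_mk_of_subset (hQ Set.subset_union_left)).trans ((hQcard _ hinf).trans
        (le_aleph0_iff_set_countable.2 (hY.union (Set.countable_range _))))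
    obtain ⟨Z, hZc, hZ⟩ := exists_superset_map_mem hP (hPccc _) hPfin φ le_rfl hQY
    refine relPiWeight_le_aleph0_of_orderIso φ (B := A X) (E := A (X ∪ Z)) ?_ ?_ ?_ ?_
      (hApi X Z (le_aleph0_iff_set_countable.1 hZc))
    · rw [hB, hB]
      exact subCompletion_mono (hQ Set.subset_union_left)
    · intro M hM
      rw [hB] at hM ⊢
      exact sSup_mem_completeClosure hM
    -- The inverse direction is needed here: elements of `A X` used in the dense subalgebra must
    -- come from `B X`.
    · intro a ha
      rw [hA] at ha
      rw [hB]
      exact hψ.map_mem ha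
    · intro b hb
      -- By (e) it suffices to locate the images of `B X` and `B Y` separately, in `A X` and in `A
      -- Z`.
      rw [hBgen] at hb
      refine map_mem_of_mem_completeClosure φ (hcompl _) ?_ hb
      rintro b (hb | hb)
      · rw [hB] at hb
        rw [hA]
        exact subCompletion_mono (hP Set.subset_union_left) (hφ.map_mem hb)
      · rw [hB] at hb
        refine map_mem_of_mem_completeClosure φ (hcompl _) ?_ hb
        rintro _ ⟨q, hq, rfl⟩
        rw [hA]
        exact subCompletion_mono (hP Set.subset_union_right) (hZ q hq)
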